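/- Let $(\mathscr{A},\tau)$ be a tracial noncommutative probability space, i.e. a unital $C^\star$-algebra $\mathscr{A}$ with a tracial state $\tau$. A free unitary Brownian motion in $(\mathscr{A},\tau)$ is a family $(U_t)_{t\ge 0}$ of unitaries with $U_0=\mathbf 1$ such that, for all $t_0\le t_1\le\dots\le t_n$, the increments $U_{t_{i-1}}^\star U_{t_i}$, $1\le i\le n$, are $\star$-free, and such that for $s\le t$, $n\ge 1$, $$\tau\big[(U_s^\star U_t)^n\big]=e^{-n(t-s)/2}\sum_{j=0}^{n-1}\frac{(-(t-s))^j}{j!}\,n^{j-1}\binom{n}{j+1}.$$ The distribution of $a\in\mathscr{A}$ is the linear functional $p\mapsto\tau(p(a,a^\star))$ on polynomials $p$ in two noncommuting indeterminates. The Brown measure of $a$ is the measure $\frac1{2\pi}\nabla^2_\lambda\log\Delta(a-\lambda)$ on $\mathbb{C}$ (in the sense of distributions), where $\Delta(a)=\inf_{\varepsilon>0}\exp\big(\tfrac12\tau[\log(a^\star a+\varepsilon)]\big)$ is the Fuglede--Kadison determinant. The spectral distribution of a self-adjoint $x\in\mathscr{A}$ is the Borel measure $\mu$ on $\mathbb{R}$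 with $\int f\,d\mu=\tau(f(x))$ for every compactly supported continuous $f$. Let $k\ge 2$ be an integer, let $(U_t)_{t\ge0}$ be a free unitary Brownian motion in $(\mathscr{A},\tau)$, and let $P\in\mathscr{A}$ be a self-adjoint projection with $\tau(P)=1/k$ that is free from $\{U_s,U_s^\star\}_{s\ge0}$. Let $(U^1_t)_{t\ge0},\dots,(U^k_t)_{t\ge0}$ be $k$ $\star$-free free unitary Brownian motions in $(\mathscr{A},\tau)$, and put $G^k_t=U^1_t+\dots+U^k_t$. Then, for every $t\ge0$: 1. the distribution of $PU_tP$ in the compressed space $(P\mathscr{A}P,k\tau)$ (whose unit is $P$) coincides with the distribution of $G^k_t/k$ in $(\mathscr{A},\tau)$; 2. the Brown measure of $PU_tP$ in $(P\mathscr{A}P,k\tau)$ coincides with the Brown measure of $G^k_t/k$ in $(\mathscr{A},\tau)$; 3. the spectral distribution of the radial part $(PU_tP)(PU_tP)^\star=PU_tPU_t^\star P$ in $(P\mathscr{A}P,k\tau)$ coincides with that of the radial part $(G^k_t/k)(G^k_t/k)^\star$ in $(\mathscr{A},\tau)$. -/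

import Mathlib

open scoped NNReal ComplexOrder CompactlySupported ContDiff

noncomputable section

namespace FreeProb

/-! ### Tracial noncommutative probability spaces -/

/-- A tracial state on a unital C⋆-algebra `A`; the pair `(A, τ)` is a tracial noncommutative
probability space.  (Faithfulness and normality are not needed, so finite von Neumann algebras with
a faithful normal tracial state are a special case.) -/
structure TracialState (A : Type*) [CStarAlgebra A] where
  /-- The underlying linear functional. -/
  toLinearMap : A →ₗ[ℂ] ℂ
  map_one : toLinearMap 1 = 1
  nonneg : ∀ a : A, 0 ≤ toLinearMap (star a * a)
  trace : ∀ a b : A, toLinearMap (a * b) = toLinearMap (b * a)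

instance {A : Type*} [CStarAlgebra A] : CoeFun (TracialState A) (fun _ => A → ℂ) :=
  ⟨fun τ => τ.toLinearMap⟩

/-- Freeness of a family of unital ⋆-subalgebras: an alternating product of centered elements,
in which neighbouring factors come from different subalgebras, is centered.  A nonempty word is a
list of pairs `(i, a)` with `a ∈ S i`. -/
def IsFree {A : Type*} [CStarAlgebra A] (τ : TracialState A) {ι : Type*}
    (S : ι → StarSubalgebra ℂ A) : Prop :=
  ∀ w : List (ι × A), w ≠ [] → w.IsChain (fun x y => x.1 ≠ y.1) →
    (∀ x ∈ w, x.2 ∈ S x.1 ∧ τ x.2 = 0) → τ (w.map Prod.snd).prod = 0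

/-- The distribution (all ⋆-moments) of `a`: the linear functional on polynomials in two
noncommuting indeterminates `X₀, X₁` sending `p` to `τ (p (a, a⋆))`. -/
def starDistribution {A : Type*} [CStarAlgebra A] (τ : TracialState A) (a : A) :
    FreeAlgebra ℂ (Fin 2) →ₗ[ℂ] ℂ :=
  τ.toLinearMap ∘ₗ (FreeAlgebra.lift ℂ ![a, star a]).toLinearMap

/-! ### Spectral distribution of a self-adjoint element -/

/-- The positive functional `f ↦ τ (f x)` (continuous functional calculus) on `C_c(ℝ, ℝ)`. -/
def spectralFunctional {A : Type*} [CStarAlgebra A] (τ : TracialState A) (x : A) :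
    C_c(ℝ, ℝ) →ₚ[ℝ] ℝ :=
  PositiveLinearMap.mk₀
    { toFun := fun f => (τ (cfc (fun s : ℝ => f s) x)).re
      map_add' := by
        intro f g
        have h : cfc (fun s : ℝ => (f + g) s) x
            = cfc (fun s : ℝ => f s) x + cfc (fun s : ℝ => g s) x :=
          cfc_add x (fun s : ℝ => f s) (fun s : ℝ => g s) f.continuous.continuousOn
            g.continuous.continuousOn
        rw [h, map_add, Complex.add_re]
      map_smul' := by
        intro c f
        have h : cfc (fun s : ℝ => (c • f) s) x = (c : ℂ) • cfc (fun s : ℝ => f s) x := by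
          rw [Complex.coe_smul]
          exact cfc_smul c (fun s : ℝ => f s) x f.continuous.continuousOn
        rw [h, map_smul]
        simp }
    (by
      intro f hf
      have hf' : ∀ s : ℝ, 0 ≤ f s := fun s => hf s
      have hc : Continuous fun s : ℝ => Real.sqrt (f s) := Real.continuous_sqrt.comp f.continuous
      have h : cfc (fun s : ℝ => f s) x
          = star (cfc (fun s : ℝ => Real.sqrt (f s)) x) * cfc (fun s : ℝ => Real.sqrt (f s)) x := by
        rw [(cfc_predicate (fun s : ℝ => Real.sqrt (f s)) x : IsSelfAdjoint _).star_eq,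
          ← cfc_mul _ _ x hc.continuousOn hc.continuousOn]
        exact cfc_congr fun s _ => (Real.mul_self_sqrt (hf' s)).symm
      change 0 ≤ (τ (cfc (fun s : ℝ => f s) x)).re
      rw [h]
      exact (Complex.nonneg_iff.mp (τ.nonneg _)).1)

/-- The spectral distribution of a self-adjoint `x`: the Borel measure `μ` on `ℝ` that represents
`f ↦ τ (f x)`, i.e. `∫ f dμ = τ (f x)` for all `f ∈ C_c(ℝ, ℝ)`. -/
def spectralDistribution {A : Type*} [CStarAlgebra A] (τ : TracialState A) (x : A)
    (_hx : IsSelfAdjoint x) : MeasureTheory.Measure ℝ :=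
  RealRMK.rieszMeasure (spectralFunctional τ x)

/-! ### Brown measure -/

/-- The Fuglede–Kadison determinant
`Δ(a) = inf_{ε > 0} exp (τ (log (a⋆ a + ε)) / 2) ∈ [0, ∞)`. -/
def fkDet {A : Type*} [CStarAlgebra A] (τ : TracialState A) (a : A) : ℝ :=
  ⨅ ε : {ε : ℝ // 0 < ε},
    Real.exp ((τ (cfc Real.log (star a * a + algebraMap ℝ A ε.1))).re / 2)

/-- The distribution `(1 / 2π) ∇² log Δ(a - z)` on `ℂ ≅ ℝ²`, evaluated at a test function `f`.
(The points `z` with `Δ(a - z) = 0`, at which `Real.log` has a conventional value, form a Lebesgue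
null set, because `z ↦ log Δ(a - z)` is subharmonic and not identically `-∞`.) -/
def brownDistribution {A : Type*} [CStarAlgebra A] (τ : TracialState A) (a : A)
    (f : ℂ → ℝ) : ℝ :=
  (1 / (2 * Real.pi)) *
    ∫ z : ℂ, Laplacian.laplacian f z * Real.log (fkDet τ (a - algebraMap ℂ A z))

/-- `μ` is the Brown measure of `a`: the locally finite Borel measure on `ℂ` that equals
`(1 / 2π) ∇² log Δ(a - z)` in the sense of distributions. -/
def IsBrownMeasure {A : Type*} [CStarAlgebra A] (τ : TracialState A) (a : A)
    (μ : MeasureTheory.Measure ℂ) : Prop :=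
  MeasureTheory.IsLocallyFiniteMeasure μ ∧
    ∀ f : ℂ → ℝ, ContDiff ℝ ∞ f → HasCompactSupport f → ∫ z, f z ∂μ = brownDistribution τ a f

/-! ### Free unitary Brownian motion -/

/-- The `n`-th moment (`n ≥ 1`) of the law at time `t` of the free unitary Brownian motion:
`e^{-nt/2} ∑_{j=0}^{n-1} (-t)^j / j! · n^{j-1} · binom(n, j+1)`. -/
def fubmMoment (t : ℝ) (n : ℕ) : ℝ :=
  Real.exp (-(n * t) / 2) *
    ∑ j ∈ Finset.range n,
      (-t) ^ j / (j.factorial : ℝ) * (n : ℝ) ^ ((j : ℤ) - 1) * (n.choose (j + 1) : ℝ)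

/-- Free unitary Brownian motion: a process of unitaries started at `1`, with free and stationary
multiplicative increments `U_s⋆ U_t`, whose law at lag `t - s` is the one with moments
`fubmMoment (t - s)`. -/
structure IsFreeUnitaryBrownianMotion {A : Type*} [CStarAlgebra A] (τ : TracialState A)
    (U : ℝ≥0 → A) : Prop where
  unitary : ∀ t, U t ∈ unitary A
  zero : U 0 = 1
  free_increments : ∀ (n : ℕ) (s : Fin (n + 1) → ℝ≥0), Monotone s →
    IsFree τ fun i : Fin n => StarAlgebra.adjoin ℂ {star (U (s i.castSucc)) * U (s i.succ)}
  law : ∀ s t : ℝ≥0, s ≤ t → ∀ n : ℕ, 1 ≤ n →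
    τ ((star (U s) * U t) ^ n) = (fubmMoment ((t : ℝ) - s) n : ℂ)

/-! ### The compressed space `(P A P, k τ)` -/

section Corner

variable {A : Type*} [CStarAlgebra A] {P : A}

/-- The compressed algebra `P A P` with unit `P`. -/
def Corner (hP : IsStarProjection P) : Type _ := hP.isIdempotentElem.Corner

namespace Corner

instance (hP : IsStarProjection P) : Ring (Corner hP) :=
  inferInstanceAs (Ring hP.isIdempotentElem.Corner)

/-- The inclusion `P A P → A` (it does not preserve the unit). -/
def val (hP : IsStarProjection P) : Corner hP →ₙ+* A where
  toFun x := x.1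
  map_mul' _ _ := rfl
  map_zero' := rfl
  map_add' _ _ := rfl

/-- The element `P a P` of the compressed algebra. -/
def compress (hP : IsStarProjection P) (a : A) : Corner hP := ⟨P * a * P, a, rfl⟩

theorem val_injective (hP : IsStarProjection P) : Function.Injective (val hP) :=
  Subtype.val_injective

theorem val_compress (hP : IsStarProjection P) (a : A) : val hP (compress hP a) = P * a * P := rfl

theorem val_one (hP : IsStarProjection P) : val hP 1 = P := rfl

theorem mul_val_mul (hP : IsStarProjection P) (x : Corner hP) : P * val hP x * P = val hP x := by
  have h := (Subsemigroup.mem_corner_iff hP.isIdempotentElem).mp x.2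
  change P * x.1 * P = x.1
  rw [h.1, h.2]

instance (hP : IsStarProjection P) : StarRing (Corner hP) where
  star x := compress hP (star (val hP x))
  star_involutive x := by
    apply val_injective hP
    rw [val_compress, val_compress, star_mul, star_mul, star_star, hP.isSelfAdjoint.star_eq,
      ← mul_assoc P (val hP x) P, mul_val_mul, mul_val_mul]
  star_mul x y := by
    have key : ∀ z : Corner hP, val hP (compress hP (star (val hP z))) = star (val hP z) := by
      intro z
      rw [val_compress]
      conv_rhs => rw [← mul_val_mul hP z, star_mul, star_mul, hP.isSelfAdjoint.star_eq, ← mul_assoc]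
    apply val_injective hP
    rw [key, map_mul, map_mul, key, key, star_mul]
  star_add x y := by
    apply val_injective hP
    rw [map_add]
    simp only [val_compress, map_add, star_add, mul_add, add_mul]

theorem val_star (hP : IsStarProjection P) (x : Corner hP) :
    val hP (star x) = star (val hP x) := by
  change val hP (compress hP (star (val hP x))) = star (val hP x)
  rw [val_compress]
  conv_rhs => rw [← mul_val_mul hP x, star_mul, star_mul, hP.isSelfAdjoint.star_eq, ← mul_assoc]

instance (hP : IsStarProjection P) : SMul ℂ (Corner hP) :=
  ⟨fun c x => compress hP (c • val hP x)⟩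

theorem val_smul (hP : IsStarProjection P) (c : ℂ) (x : Corner hP) :
    val hP (c • x) = c • val hP x := by
  change P * (c • val hP x) * P = c • val hP x
  rw [mul_smul_comm, smul_mul_assoc, mul_val_mul]

instance (hP : IsStarProjection P) : Module ℂ (Corner hP) :=
  Function.Injective.module ℂ (val hP : Corner hP →+ A) (val_injective hP) (val_smul hP)

instance (hP : IsStarProjection P) : Algebra ℂ (Corner hP) :=
  Algebra.ofModule
    (fun c x y => val_injective hP (by
      rw [map_mul, val_smul, val_smul, map_mul, smul_mul_assoc]))
    (fun c x y => val_injective hP (by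
      rw [map_mul, val_smul, val_smul, map_mul, mul_smul_comm]))

/-- The norm of `P A P` is the one of `A`. -/
instance (hP : IsStarProjection P) : NormedRing (Corner hP) :=
  NormedRing.induced (Corner hP) A (val hP) (val_injective hP)

theorem norm_val (hP : IsStarProjection P) (x : Corner hP) : ‖val hP x‖ = ‖x‖ := rfl

theorem isometry_val (hP : IsStarProjection P) : Isometry (val hP) :=
  AddMonoidHomClass.isometry_of_norm (val hP) (norm_val hP)

instance (hP : IsStarProjection P) : NormedAlgebra ℂ (Corner hP) where
  norm_smul_le c x := by rw [← norm_val, val_smul, norm_smul, norm_val]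

instance (hP : IsStarProjection P) : CompleteSpace (Corner hP) := by
  have hr : Set.range (val hP) = {a : A | P * a * P = a} := by
    ext a
    constructor
    · rintro ⟨x, rfl⟩
      exact mul_val_mul hP x
    · intro ha
      exact ⟨compress hP a, ha⟩
  rw [completeSpace_iff_isComplete_range (isometry_val hP).isUniformInducing, hr]
  exact (isClosed_eq (by fun_prop) continuous_id).isComplete

/-- `P A P` is a C⋆-algebra. -/
instance (hP : IsStarProjection P) : CStarAlgebra (Corner hP) where
  norm_mul_self_le x := by
    rw [← norm_val, ← norm_val, map_mul, val_star, CStarRing.norm_star_mul_self]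
  star_smul c x := val_injective hP (by
    rw [val_star, val_smul, val_smul, val_star, star_smul])

end Corner

/-- The tracial state `k τ` on `P A P`, where `τ(P) = 1/k`. -/
def TracialState.compress (τ : TracialState A) (hP : IsStarProjection P) (k : ℕ)
    (hk : k ≠ 0) (hτ : τ P = 1 / (k : ℂ)) : TracialState (Corner hP) where
  toLinearMap :=
    { toFun := fun x => (k : ℂ) * τ (Corner.val hP x)
      map_add' := fun x y => by rw [map_add, map_add, mul_add]
      map_smul' := fun c x => by
        rw [Corner.val_smul, map_smul, smul_eq_mul, RingHom.id_apply, smul_eq_mul]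
        ring }
  map_one := by
    change (k : ℂ) * τ (Corner.val hP 1) = 1
    rw [Corner.val_one, hτ]
    exact mul_one_div_cancel (Nat.cast_ne_zero.mpr hk)
  nonneg x := by
    change 0 ≤ (k : ℂ) * τ (Corner.val hP (star x * x))
    rw [map_mul, Corner.val_star]
    exact mul_nonneg (Nat.cast_nonneg k) (τ.nonneg _)
  trace x y := by
    change (k : ℂ) * τ (Corner.val hP (x * y)) = (k : ℂ) * τ (Corner.val hP (y * x))
    rw [map_mul (Corner.val hP), map_mul (Corner.val hP), τ.trace]

end Corner

end FreeProb

end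

/-! The pair (`P`, `U t`) is replaced by a matrix model with the same joint ⋆-moments. In the `k ×
k` matrices over `A`, with the normalized trace, let `D` be the diagonal matrix of the `V j t` and
let `E` be the averaging projection, all of whose entries are `1/k`. Each `V j t` is a unitary with
the same moments as `U t`, so `D` has the ⋆-distribution of `U t`, and `E` has trace `1/k`. Moreover
`E` is free from `D` (`matrixTrace_wordEval_eq_zero`): `E - 1/k` has zero diagonal, so in an entry
of an alternating word the row index must change at each factor `E - 1/k`, and neighbouring centered
letters come from different free algebras. Freeness determines joint moments
(`eq_of_vanish_on_alternating`), so compressing `U t` by `P` amounts to compressing `D` by `E`. The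
product `E D E` is the constant matrix attached to the average `Y` of the `V j t`, and `a ↦
constMatrix k a` identifies `A` with the corner of `E`, with trace `τ a / k`. This gives equality of
⋆-distributions.

Brown measures and radial spectral distributions are built from traces of continuous functions of
self-adjoint ⋆-polynomials. By Weierstrass approximation and positivity of the trace, they depend
only on the ⋆-distribution (`re_cfc_eq_of_moments`). -/

noncomputable section

namespace FreeProb

/-! ### Alternating words in a projection and an algebra -/

section Alternating

variable {F R : Type*} [Ring F] [Algebra ℂ F] [Ring R] [Algebra ℂ R]

/-- Evaluation of a letter: `none` stands for the centered projection `p - α`, and `some f` for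
the image of `f`. -/
def letterEval (π : F →ₐ[ℂ] R) (p : R) (α : ℂ) : Option F → R
  | none => p - algebraMap ℂ R α
  | some f => π f

/-- Evaluation of a word as the product of its letters. -/
def wordEval (π : F →ₐ[ℂ] R) (p : R) (α : ℂ) (w : List (Option F)) : R :=
  (w.map (letterEval π p α)).prod

/-- An alternating word whose letters from `F` are centered with respect to `ψ`. -/
def IsAlternating (ψ : F →ₗ[ℂ] ℂ) (w : List (Option F)) : Prop :=
  w.IsChain (fun x y => x.isSome ≠ y.isSome) ∧ ∀ f, some f ∈ w → ψ f = 0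

theorem wordEval_nil (π : F →ₐ[ℂ] R) (p : R) (α : ℂ) : wordEval π p α [] = 1 := rfl

theorem wordEval_cons (π : F →ₐ[ℂ] R) (p : R) (α : ℂ) (x : Option F) (w : List (Option F)) :
    wordEval π p α (x :: w) = letterEval π p α x * wordEval π p α w := by
  simp [wordEval]

theorem IsAlternating.tail {ψ : F →ₗ[ℂ] ℂ} {x : Option F} {w : List (Option F)}
    (h : IsAlternating ψ (x :: w)) : IsAlternating ψ w :=
  ⟨h.1.tail, fun f hf => h.2 f (List.mem_cons_of_mem _ hf)⟩

theorem IsAlternating.none_cons {ψ : F →ₗ[ℂ] ℂ} {w : List (Option F)} (h : IsAlternating ψ w)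
    (hw : ∀ x ∈ w.head?, x.isSome = true) : IsAlternating ψ (none :: w) := by
  refine ⟨List.isChain_cons.2 ⟨fun x hx => by simp [hw x hx], h.1⟩, fun f hf => ?_⟩
  exact h.2 f (by simpa using hf)

theorem IsAlternating.some_cons {ψ : F →ₗ[ℂ] ℂ} {w : List (Option F)} (h : IsAlternating ψ w)
    {f : F} (hf : ψ f = 0) (hw : ∀ x ∈ w.head?, x.isSome = false) :
    IsAlternating ψ (some f :: w) := by
  refine ⟨List.isChain_cons.2 ⟨fun x hx => by simp [hw x hx], h.1⟩, fun g hg => ?_⟩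
  rcases List.mem_cons.1 hg with hg | hg
  · rw [Option.some.inj hg, hf]
  · exact h.2 g hg

theorem IsAlternating.head_tail {ψ : F →ₗ[ℂ] ℂ} {x : Option F} {w : List (Option F)}
    (h : IsAlternating ψ (x :: w)) : ∀ y ∈ w.head?, x.isSome ≠ y.isSome :=
  (List.isChain_cons.1 h.1).1

variable {R' : Type*} [Ring R'] [Algebra ℂ R']

/-- Joint evaluations of alternating words in two algebras. -/
def alternatingSpan (ψ : F →ₗ[ℂ] ℂ) (π : F →ₐ[ℂ] R) (π' : F →ₐ[ℂ] R') (p : R) (p' : R')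
    (α : ℂ) : Submodule ℂ (R × R') :=
  Submodule.span ℂ
    {a | ∃ w, IsAlternating ψ w ∧ a = (wordEval π p α w, wordEval π' p' α w)}

theorem mul_mem_span_of_forall {S : Type*} [Ring S] [Algebra ℂ S] {s : Set S}
    {N : Submodule ℂ S} {a b : S} (h : ∀ x ∈ s, a * x ∈ N) (hb : b ∈ Submodule.span ℂ s) :
    a * b ∈ N := by
  have : Submodule.span ℂ s ≤ N.comap (LinearMap.mulLeft ℂ a) := Submodule.span_le.2 h
  exact this hb

/-- Idempotency gives `q (q - α) = (1 - α) q`, and `q = (q - α) + α`. -/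
theorem idempotent_mul_centered {S : Type*} [Ring S] [Algebra ℂ S] (α : ℂ) {q : S}
    (hq : q * q = q) (v : S) :
    q * ((q - algebraMap ℂ S α) * v) = (1 - α) • ((q - algebraMap ℂ S α) * v + α • v) := by
  rw [Algebra.algebraMap_eq_smul_one, sub_mul, smul_mul_assoc, one_mul, sub_add_cancel,
    mul_sub, ← mul_assoc, hq, mul_smul_comm, sub_smul, one_smul]

/-- A word that does not begin with the centered projection absorbs `p = (p - α) + α`; otherwise
idempotency reduces the product. The coefficients are the same in both algebras, which is what
working with pairs records. -/
theorem proj_mul_mem_alternatingSpan {ψ : F →ₗ[ℂ] ℂ} {π : F →ₐ[ℂ] R} {π' : F →ₐ[ℂ] R'} {p : R}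
    {p' : R'} {α : ℂ} (hp : p * p = p) (hp' : p' * p' = p') {b : R × R'}
    (hb : b ∈ alternatingSpan ψ π π' p p' α) :
    (p, p') * b ∈ alternatingSpan ψ π π' p p' α := by
  refine mul_mem_span_of_forall ?_ hb
  rintro _ ⟨w, hw, rfl⟩
  have mem : ∀ v, IsAlternating ψ v →
      (wordEval π p α v, wordEval π' p' α v) ∈ alternatingSpan ψ π π' p p' α :=
    fun v hv => Submodule.subset_span ⟨v, hv, rfl⟩
  by_cases hh : ∀ x ∈ w.head?, x.isSome = true
  · convert Submodule.add_mem _ (mem _ (hw.none_cons hh)) (Submodule.smul_mem _ α (mem _ hw))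
      using 1
    simp [wordEval_cons, letterEval, sub_mul, Algebra.smul_def]
  · cases w with
    | nil => simp at hh
    | cons x w =>
      cases x with
      | some f => simp at hh
      | none =>
        convert Submodule.smul_mem _ (1 - α) (Submodule.add_mem _ (mem _ hw)
          (Submodule.smul_mem _ α (mem _ hw.tail))) using 1
        simp only [wordEval_cons, letterEval, Prod.mk_mul_mk, Prod.smul_mk, Prod.mk_add_mk]
        rw [idempotent_mul_centered α hp, idempotent_mul_centered α hp']

/-- A leading letter `g` from `F` merges with `f` into `f * g`. The resulting letter is then split
into its centered part and its mean under `ψ`. -/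
theorem map_mul_mem_alternatingSpan {ψ : F →ₗ[ℂ] ℂ} (hψ : ψ 1 = 1) {π : F →ₐ[ℂ] R}
    {π' : F →ₐ[ℂ] R'} {p : R} {p' : R'} {α : ℂ} (f : F) {b : R × R'}
    (hb : b ∈ alternatingSpan ψ π π' p p' α) :
    (π f, π' f) * b ∈ alternatingSpan ψ π π' p p' α := by
  refine mul_mem_span_of_forall ?_ hb
  rintro _ ⟨w, hw, rfl⟩
  have mem : ∀ v, IsAlternating ψ v →
      (wordEval π p α v, wordEval π' p' α v) ∈ alternatingSpan ψ π π' p p' α :=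
    fun v hv => Submodule.subset_span ⟨v, hv, rfl⟩
  have center : ∀ g : F, ψ (g - algebraMap ℂ F (ψ g)) = 0 := fun g => by
    rw [Algebra.algebraMap_eq_smul_one, map_sub, map_smul, hψ, smul_eq_mul, mul_one, sub_self]
  by_cases hh : ∀ x ∈ w.head?, x.isSome = false
  · convert Submodule.add_mem _ (mem _ (hw.some_cons (center f) hh))
      (Submodule.smul_mem _ (ψ f) (mem _ hw)) using 1
    simp [wordEval_cons, letterEval, sub_mul, Algebra.smul_def]
  · cases w with
    | nil => simp at hh
    | cons x w =>
      cases x with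
      | none => simp at hh
      | some g =>
        have hw' : ∀ x ∈ w.head?, x.isSome = false := fun x hx => by
          simpa using hw.head_tail x hx
        convert Submodule.add_mem _ (mem _ (hw.tail.some_cons (center (f * g)) hw'))
          (Submodule.smul_mem _ (ψ (f * g)) (mem _ hw.tail)) using 1
        simp [wordEval_cons, letterEval, sub_mul, Algebra.smul_def, mul_assoc]

/-- Left multipliers of a submodule of an algebra. -/
def leftMultipliers {S : Type*} [Ring S] [Algebra ℂ S] (N : Submodule ℂ S) : Subalgebra ℂ S where
  carrier := {a | ∀ b ∈ N, a * b ∈ N}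
  mul_mem' := fun {a b} ha hb c hc => by rw [mul_assoc]; exact ha _ (hb _ hc)
  add_mem' := fun {a b} ha hb c hc => by rw [add_mul]; exact N.add_mem (ha _ hc) (hb _ hc)
  algebraMap_mem' := fun r c hc => by rw [← Algebra.smul_def]; exact N.smul_mem _ hc

/-- The joint moments of an idempotent `p` and an algebra `F` are determined by the vanishing of
`φ` on alternating centered words, by `φ ∘ π` and by the weight `α`. -/
theorem eq_of_vanish_on_alternating {ψ : F →ₗ[ℂ] ℂ} (hψ : ψ 1 = 1) {π : F →ₐ[ℂ] R}
    {π' : F →ₐ[ℂ] R'} {p : R} {p' : R'} {α : ℂ} (hp : p * p = p) (hp' : p' * p' = p')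
    {φ : R →ₗ[ℂ] ℂ} {φ' : R' →ₗ[ℂ] ℂ} (h1 : φ 1 = 1) (h1' : φ' 1 = 1)
    (h : ∀ w, w ≠ [] → IsAlternating ψ w → φ (wordEval π p α w) = 0)
    (h' : ∀ w, w ≠ [] → IsAlternating ψ w → φ' (wordEval π' p' α w) = 0) {a : R × R'}
    (ha : a ∈ Algebra.adjoin ℂ (insert (p, p') (Set.range fun f => (π f, π' f)))) :
    φ a.1 = φ' a.2 := by
  have hle : Algebra.adjoin ℂ (insert (p, p') (Set.range fun f => (π f, π' f)))
      ≤ leftMultipliers (alternatingSpan ψ π π' p p' α) := by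
    refine Algebra.adjoin_le (Set.insert_subset (fun b hb =>
      proj_mul_mem_alternatingSpan hp hp' hb) ?_)
    rintro _ ⟨f, rfl⟩ b hb
    exact map_mul_mem_alternatingSpan hψ f hb
  -- The empty word evaluates to `1`, so a left multiplier of the span lies in the span.
  have hmem : a ∈ alternatingSpan ψ π π' p p' α := by
    have := hle ha 1 (Submodule.subset_span ⟨[], ⟨List.isChain_nil, by simp⟩, rfl⟩)
    rwa [mul_one] at this
  have hker : alternatingSpan ψ π π' p p' α
      ≤ LinearMap.ker (φ ∘ₗ LinearMap.fst ℂ R R' - φ' ∘ₗ LinearMap.snd ℂ R R') := by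
    refine Submodule.span_le.2 ?_
    rintro _ ⟨w, hw, rfl⟩
    by_cases hn : w = []
    · subst hn
      simp [wordEval_nil, h1, h1']
    · simp [h w hn hw, h' w hn hw]
  simpa [sub_eq_zero] using hker hmem

end Alternating

/-! ### The diagonal matrix model -/

section MatrixModel

variable {A : Type*} [CStarAlgebra A]

/-- The span of the alternating centered words in a family of algebras whose first index
satisfies `Q`. -/
def headSpan (τ : TracialState A) {ι : Type*} (S : ι → StarSubalgebra ℂ A) (Q : Option ι → Prop) :
    Submodule ℂ A :=
  Submodule.span ℂ {a | ∃ w : List (ι × A), w.IsChain (fun x y => x.1 ≠ y.1) ∧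
    (∀ x ∈ w, x.2 ∈ S x.1 ∧ τ x.2 = 0) ∧ Q (w.head?.map Prod.fst) ∧
    a = (w.map Prod.snd).prod}

theorem headSpan_mono (τ : TracialState A) {ι : Type*} (S : ι → StarSubalgebra ℂ A)
    {Q Q' : Option ι → Prop} (h : ∀ o, Q o → Q' o) : headSpan τ S Q ≤ headSpan τ S Q' :=
  Submodule.span_mono fun _ ⟨w, h1, h2, h3, h4⟩ => ⟨w, h1, h2, h _ h3, h4⟩

theorem algebraMap_mem_headSpan (τ : TracialState A) {ι : Type*} (S : ι → StarSubalgebra ℂ A)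
    {Q : Option ι → Prop} (hQ : Q none) (c : ℂ) : algebraMap ℂ A c ∈ headSpan τ S Q := by
  rw [Algebra.algebraMap_eq_smul_one]
  exact Submodule.smul_mem _ _ (Submodule.subset_span
    ⟨[], List.isChain_nil, by simp, hQ, by simp⟩)

/-- The condition `(· ≠ some i)` admits the empty word, whose head is `none`, so one-letter words
are covered too. -/
theorem mul_mem_headSpan {τ : TracialState A} {ι : Type*} {S : ι → StarSubalgebra ℂ A} {i : ι}
    {a b : A} (ha : a ∈ S i) (ha0 : τ a = 0) (hb : b ∈ headSpan τ S (· ≠ some i)) :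
    a * b ∈ headSpan τ S (· = some i) := by
  refine mul_mem_span_of_forall ?_ hb
  rintro _ ⟨w, h1, h2, h3, rfl⟩
  refine Submodule.subset_span ⟨(i, a) :: w, List.isChain_cons.2 ⟨?_, h1⟩, ?_, rfl, by simp⟩
  · intro y hy hiy
    apply h3
    rw [Option.mem_def.1 hy, Option.map_some]
    exact congrArg some hiy.symm
  · intro x hx
    rcases List.mem_cons.1 hx with rfl | hx
    · exact ⟨ha, ha0⟩
    · exact h2 x hx

theorem IsFree.eq_zero_of_mem_headSpan {τ : TracialState A} {ι : Type*}
    {S : ι → StarSubalgebra ℂ A} (hS : IsFree τ S) {a : A}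
    (ha : a ∈ headSpan τ S (· ≠ none)) : τ a = 0 := by
  have : headSpan τ S (· ≠ none) ≤ LinearMap.ker τ.toLinearMap := by
    refine Submodule.span_le.2 ?_
    rintro _ ⟨w, h1, h2, h3, rfl⟩
    exact hS w (by rintro rfl; exact h3 rfl) h1 h2
  exact this ha

variable {F : Type*} [Ring F] [Algebra ℂ F] {k : ℕ}

/-- The diagonal homomorphism built from a family of homomorphisms. -/
def diagHom (ρ : Fin k → F →ₐ[ℂ] A) : F →ₐ[ℂ] Matrix (Fin k) (Fin k) A :=
  (Matrix.diagonalAlgHom ℂ).comp (AlgHom.pi ρ)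

theorem diagHom_apply (ρ : Fin k → F →ₐ[ℂ] A) (f : F) :
    diagHom ρ f = Matrix.diagonal fun i => ρ i f := rfl

/-- The matrix all of whose entries are `a / k`. -/
def constMatrix (k : ℕ) (a : A) : Matrix (Fin k) (Fin k) A :=
  Matrix.of fun _ _ => (k : ℂ)⁻¹ • a

/-- The normalized trace on matrices over `A`. -/
def matrixTrace (τ : TracialState A) (k : ℕ) : Matrix (Fin k) (Fin k) A →ₗ[ℂ] ℂ :=
  (k : ℂ)⁻¹ • (τ.toLinearMap ∘ₗ Matrix.traceLinearMap (Fin k) ℂ A)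

theorem matrixTrace_apply (τ : TracialState A) (M : Matrix (Fin k) (Fin k) A) :
    matrixTrace τ k M = (k : ℂ)⁻¹ * ∑ i, τ (M i i) := by
  simp [matrixTrace, Matrix.trace]

theorem constMatrix_mul (hk : k ≠ 0) (a b : A) :
    constMatrix k a * constMatrix k b = constMatrix k (a * b) := by
  have : (k : ℂ) ≠ 0 := Nat.cast_ne_zero.2 hk
  ext i j
  simp only [constMatrix, Matrix.mul_apply, Matrix.of_apply, Finset.sum_const, Finset.card_univ,
    Fintype.card_fin, smul_mul_smul_comm]
  rw [← Nat.cast_smul_eq_nsmul ℂ, smul_smul]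
  congr 1
  field_simp

/-- Compressing a diagonal matrix by the averaging projection averages its entries. -/
theorem constMatrix_diagonal_constMatrix (d : Fin k → A) :
    constMatrix k 1 * Matrix.diagonal d * constMatrix k 1
      = constMatrix k ((k : ℂ)⁻¹ • ∑ i, d i) := by
  ext i j
  rw [Matrix.mul_apply]
  simp [constMatrix, Matrix.mul_diagonal, Finset.smul_sum, smul_smul]

/-- Subtracting `k⁻¹` removes exactly the diagonal of the averaging projection, so row `i` of the
product sees only the rows `l ≠ i`. -/
theorem letterEval_none_mul_apply (π : F →ₐ[ℂ] Matrix (Fin k) (Fin k) A)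
    (M : Matrix (Fin k) (Fin k) A) (i j : Fin k) :
    (letterEval π (constMatrix k 1) (k : ℂ)⁻¹ none * M) i j
      = ∑ l ∈ Finset.univ.erase i, (k : ℂ)⁻¹ • M l j := by
  have h : (constMatrix k (1 : A) * M) i j = ∑ l, (k : ℂ)⁻¹ • M l j := by
    simp [constMatrix, Matrix.mul_apply]
  rw [letterEval, sub_mul, Matrix.sub_apply, h, ← Algebra.smul_def, Matrix.smul_apply,
    ← Finset.add_sum_erase _ _ (Finset.mem_univ i), add_sub_cancel_left]

/-- The two claims feed each other. A diagonal letter puts a factor from `S i` in front of row `i`;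
a centered projection moves to a row `l ≠ i`, whose words start in `S l`. The second claim includes
the empty word, where entries are scalars. -/
theorem wordEval_diag_mem {τ : TracialState A} {S : Fin k → StarSubalgebra ℂ A}
    {ρ : Fin k → F →ₐ[ℂ] A} (hρ : ∀ i f, ρ i f ∈ S i) {ψ : F →ₗ[ℂ] ℂ}
    (hψ : ∀ i f, τ (ρ i f) = ψ f) (w : List (Option F)) (hw : IsAlternating ψ w) :
    (∀ f w', w = some f :: w' → ∀ i j,
      wordEval (diagHom ρ) (constMatrix k 1) (k : ℂ)⁻¹ w i j ∈ headSpan τ S (· = some i)) ∧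
    ((∀ x ∈ w.head?, x.isSome = false) → ∀ i j,
      wordEval (diagHom ρ) (constMatrix k 1) (k : ℂ)⁻¹ w i j ∈ headSpan τ S (· ≠ some i)) := by
  induction w with
  | nil =>
    refine ⟨by simp, fun _ i j => ?_⟩
    rw [wordEval_nil, Matrix.one_apply]
    split_ifs
    · simpa using algebraMap_mem_headSpan τ S (Q := (· ≠ some i)) (by simp) 1
    · exact Submodule.zero_mem _
  | cons x w ih =>
    obtain ⟨ih1, ih2⟩ := ih hw.tail
    cases x with
    | some f =>
      refine ⟨fun _ _ _ i j => ?_, by simp⟩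
      have hf : ψ f = 0 := hw.2 f (by simp)
      rw [wordEval_cons, letterEval, diagHom_apply, Matrix.diagonal_mul]
      refine mul_mem_headSpan (hρ i f) ((hψ i f).trans hf) (ih2 (fun y hy => ?_) i j)
      simpa using hw.head_tail y hy
    | none =>
      refine ⟨by simp, fun _ i j => ?_⟩
      rw [wordEval_cons, letterEval_none_mul_apply]
      refine Submodule.sum_mem _ fun l hl => Submodule.smul_mem _ _ ?_
      cases w with
      | nil =>
        rw [wordEval_nil, Matrix.one_apply]
        split_ifs
        · simpa using algebraMap_mem_headSpan τ S (Q := (· ≠ some i)) (by simp) 1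
        · exact Submodule.zero_mem _
      | cons y w =>
        have hy := hw.head_tail y (by simp)
        obtain ⟨g, rfl⟩ : ∃ g, y = some g := Option.ne_none_iff_exists'.1 (by simpa using hy)
        refine headSpan_mono τ S ?_ (ih1 g w rfl l j)
        rintro _ rfl h
        exact (Finset.ne_of_mem_erase hl) (Option.some.inj h)

/-- The averaging projection is free from a diagonal matrix with free, identically distributed
entries. -/
theorem matrixTrace_wordEval_eq_zero {τ : TracialState A} {S : Fin k → StarSubalgebra ℂ A}
    (hS : IsFree τ S) {ρ : Fin k → F →ₐ[ℂ] A} (hρ : ∀ i f, ρ i f ∈ S i) {ψ : F →ₗ[ℂ] ℂ}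
    (hψ : ∀ i f, τ (ρ i f) = ψ f) (w : List (Option F)) (hn : w ≠ []) (hw : IsAlternating ψ w) :
    matrixTrace τ k (wordEval (diagHom ρ) (constMatrix k 1) (k : ℂ)⁻¹ w) = 0 := by
  have key : ∀ f v, IsAlternating ψ (some f :: v) → ∀ i j,
      τ (wordEval (diagHom ρ) (constMatrix k 1) (k : ℂ)⁻¹ (some f :: v) i j) = 0 := by
    intro f v hv i j
    refine hS.eq_zero_of_mem_headSpan
      (headSpan_mono τ S ?_ ((wordEval_diag_mem hρ hψ _ hv).1 f v rfl i j))
    rintro _ rfl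
    simp
  rw [matrixTrace_apply]
  refine mul_eq_zero_of_right _ (Finset.sum_eq_zero fun i _ => ?_)
  rcases w with _ | ⟨_ | f, w⟩
  · exact absurd rfl hn
  -- Removing the leading centered projection leaves entries `(l, i)` with `l ≠ i`: these are
  -- off-diagonal entries of `1`, or entries of a word starting with a diagonal letter. This is why
  -- `key` covers all entries.
  · rw [wordEval_cons, letterEval_none_mul_apply, map_sum]
    refine Finset.sum_eq_zero fun l hl => ?_
    rw [map_smul]
    rcases w with _ | ⟨y, w⟩
    · rw [wordEval_nil, Matrix.one_apply_ne (Finset.ne_of_mem_erase hl), map_zero, smul_zero]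
    · have hy := hw.head_tail y (by simp)
      obtain ⟨g, rfl⟩ : ∃ g, y = some g := Option.ne_none_iff_exists'.1 (by simpa using hy)
      rw [key g w hw.tail, smul_zero]
  · exact key f w hw i i

end MatrixModel

/-! ### Compression by a free projection -/

section Compression

variable {A : Type*} [CStarAlgebra A]

/-- Polarization: positivity makes the trace real at `star x * x`. Taking `x = 1 + a` shows that `τ
a + τ (star a)` is real, and `x = 1 + i a` that `τ a - τ (star a)` is imaginary. -/
theorem TracialState.map_star (τ : TracialState A) (a : A) : τ (star a) = star (τ a) := by
  have hre : ∀ x : A, star (τ (star x * x)) = τ (star x * x) := fun x =>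
    (IsSelfAdjoint.of_nonneg (τ.nonneg x)).star_eq
  have h1 := hre (1 + a)
  have h2 := hre (1 + Complex.I • a)
  have h3 := hre a
  have e1 : star (1 + a) * (1 + a) = 1 + a + star a + star a * a := by
    rw [star_add, star_one]; noncomm_ring
  have e2 : star (1 + Complex.I • a) * (1 + Complex.I • a)
      = 1 + Complex.I • a - Complex.I • star a + star a * a := by
    rw [star_add, star_one, star_smul, add_mul, mul_add, mul_add, smul_mul_smul_comm]
    simp
    abel
  rw [e1] at h1
  rw [e2] at h2
  simp only [map_add, map_sub, map_smul, τ.map_one, star_add, star_sub, star_one, h3, smul_eq_mul,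
    star_mul'] at h1 h2
  have hI : star Complex.I = -Complex.I := Complex.conj_I
  rw [hI] at h2
  have h4 : Complex.I * (τ a + star (τ a) - τ (star a) - star (τ (star a))) = 0 := by
    linear_combination -h2
  have h5 := (mul_eq_zero.1 h4).resolve_left Complex.I_ne_zero
  linear_combination (-1 / 2 : ℂ) * h5 - (1 / 2 : ℂ) * h1

/-- Unitaries with the same holomorphic moments have the same ⋆-distribution. -/
theorem starDistribution_eq_of_unitary {B : Type*} [CStarAlgebra B] (τ : TracialState A)
    (τ' : TracialState B) {u : A} {v : B} (hu : u ∈ unitary A) (hv : v ∈ unitary B)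
    (h : ∀ n : ℕ, 1 ≤ n → τ (u ^ n) = τ' (v ^ n)) :
    starDistribution τ u = starDistribution τ' v := by
  have h0 : ∀ n : ℕ, τ (u ^ n) = τ' (v ^ n) := by
    intro n
    rcases Nat.eq_zero_or_pos n with rfl | hn
    · rw [pow_zero, pow_zero, τ.map_one, τ'.map_one]
    · exact h n hn
  -- By unitarity, multiplying by `u` or `star u` only shifts the exponent, so `N` is stable under
  -- both and contains all ⋆-polynomials.
  set N : Submodule ℂ (A × B) := Submodule.span ℂ
    {a | ∃ n : ℕ, a = (u, v) ^ n ∨ a = (star u, star v) ^ n} with hN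
  have hmem : ∀ n : ℕ, (u, v) ^ n ∈ N := fun n => Submodule.subset_span ⟨n, Or.inl rfl⟩
  have hmem' : ∀ n : ℕ, (star u, star v) ^ n ∈ N := fun n =>
    Submodule.subset_span ⟨n, Or.inr rfl⟩
  have huv : (u, v) * (star u, star v) = 1 := by
    rw [Prod.mk_mul_mk, Unitary.mul_star_self_of_mem hu, Unitary.mul_star_self_of_mem hv]; rfl
  have huv' : (star u, star v) * (u, v) = 1 := by
    rw [Prod.mk_mul_mk, Unitary.star_mul_self_of_mem hu, Unitary.star_mul_self_of_mem hv]; rfl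
  have hgen : (u, v) ∈ leftMultipliers N := by
    intro b hb
    refine mul_mem_span_of_forall ?_ hb
    rintro _ ⟨n, rfl | rfl⟩
    · rw [← pow_succ']; exact hmem _
    · cases n with
      | zero => simpa using hmem 1
      | succ n => rw [pow_succ', ← mul_assoc, huv, one_mul]; exact hmem' n
  have hgen' : (star u, star v) ∈ leftMultipliers N := by
    intro b hb
    refine mul_mem_span_of_forall ?_ hb
    rintro _ ⟨n, rfl | rfl⟩
    · cases n with
      | zero => simpa using hmem' 1
      | succ n => rw [pow_succ', ← mul_assoc, huv', one_mul]; exact hmem n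
    · rw [← pow_succ']; exact hmem' _
  have hker : N ≤ LinearMap.ker
      (τ.toLinearMap ∘ₗ LinearMap.fst ℂ A B - τ'.toLinearMap ∘ₗ LinearMap.snd ℂ A B) := by
    refine Submodule.span_le.2 ?_
    rintro _ ⟨n, rfl | rfl⟩
    · simp [h0 n]
    · simp [← star_pow, TracialState.map_star, h0 n]
  ext q
  have hq : (FreeAlgebra.lift ℂ ![u, star u] q, FreeAlgebra.lift ℂ ![v, star v] q)
      ∈ leftMultipliers N := by
    induction q using FreeAlgebra.induction with
    | grade0 r => simpa using (leftMultipliers N).algebraMap_mem r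
    | grade1 x => fin_cases x <;> simpa
    | mul a b ha hb => simpa using mul_mem ha hb
    | add a b ha hb => simpa using add_mem ha hb
  have := hker (hq 1 (by simpa using hmem 0))
  simpa [sub_eq_zero, starDistribution] using this

theorem lift_mem_of_mem {S : StarSubalgebra ℂ A} {a : A} (ha : a ∈ S)
    (q : FreeAlgebra ℂ (Fin 2)) : FreeAlgebra.lift ℂ ![a, star a] q ∈ S := by
  induction q using FreeAlgebra.induction with
  | grade0 r => rw [AlgHom.commutes]; exact S.algebraMap_mem r
  | grade1 x =>
    fin_cases x
    · simpa using ha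
    · simpa using star_mem ha
  | mul a b ha hb => rw [map_mul]; exact mul_mem ha hb
  | add a b ha hb => rw [map_add]; exact add_mem ha hb

/-- Alternating centered words in a projection and an element that are free have trace zero. -/
theorem IsFree.map_wordEval_eq_zero {τ : TracialState A} {P : A} {α : ℂ} (hα : τ P = α)
    {S : StarSubalgebra ℂ A} (hS : IsFree τ ![StarAlgebra.adjoin ℂ {P}, S]) {F : Type*} [Ring F]
    [Algebra ℂ F] {π : F →ₐ[ℂ] A} (hπ : ∀ f, π f ∈ S) {ψ : F →ₗ[ℂ] ℂ} (hψ : ∀ f, τ (π f) = ψ f)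
    (w : List (Option F)) (hn : w ≠ []) (hw : IsAlternating ψ w) :
    τ (wordEval π P α w) = 0 := by
  have := hS (w.map fun x => (if x.isSome then (1 : Fin 2) else 0, letterEval π P α x))
    (by simpa using hn) ?_ ?_
  · simpa [wordEval, Function.comp_def] using this
  · rw [List.isChain_map]
    refine hw.1.imp fun x y hxy => ?_
    cases x <;> cases y <;> simp_all
  · intro x hx
    obtain ⟨y, hy, rfl⟩ := List.mem_map.1 hx
    cases y with
    | none =>
      refine ⟨?_, ?_⟩
      · exact sub_mem (StarAlgebra.subset_adjoin ℂ _ rfl) (StarSubalgebra.algebraMap_mem _ _)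
      · change τ (P - algebraMap ℂ A α) = 0
        rw [Algebra.algebraMap_eq_smul_one, map_sub, map_smul, τ.map_one, hα, smul_eq_mul, mul_one,
          sub_self]
    | some f => exact ⟨hπ f, (hψ f).trans (hw.2 f hy)⟩

/-- The compression of `a` by a free projection of trace `1 / k` is distributed as the average of
`k` free copies of `a`. -/
theorem starDistribution_compress_eq (τ : TracialState A) {k : ℕ} (hk : k ≠ 0) {P : A}
    (hP : IsStarProjection P) (hτP : τ P = 1 / (k : ℂ)) {S : StarSubalgebra ℂ A}
    (hPS : IsFree τ ![StarAlgebra.adjoin ℂ {P}, S]) {a : A} (ha : a ∈ S)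
    {T : Fin k → StarSubalgebra ℂ A} (hT : IsFree τ T) {b : Fin k → A} (hb : ∀ i, b i ∈ T i)
    (hab : ∀ i, starDistribution τ (b i) = starDistribution τ a) :
    starDistribution (τ.compress hP k hk hτP) (Corner.compress hP a)
      = starDistribution τ ((k : ℂ)⁻¹ • ∑ i, b i) := by
  have hk' : (k : ℂ) ≠ 0 := Nat.cast_ne_zero.2 hk
  set X := Corner.compress hP a
  set Y := (k : ℂ)⁻¹ • ∑ i, b i with hY
  set π := FreeAlgebra.lift ℂ ![a, star a] with hπ
  set ρ : Fin k → FreeAlgebra ℂ (Fin 2) →ₐ[ℂ] A := fun i => FreeAlgebra.lift ℂ ![b i, star (b i)]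
    with hρ
  set ψ := starDistribution τ a with hψdef
  have hψ1 : ψ 1 = 1 := by simp [hψdef, starDistribution, τ.map_one]
  have hψρ : ∀ i f, τ (ρ i f) = ψ f := fun i f => by rw [← hab i]; rfl
  -- Pairs in `C` are the same polynomial in the projection and the algebra, evaluated in the
  -- original space and in the matrix model.
  set C := Algebra.adjoin ℂ (insert (P, constMatrix k (1 : A))
    (Set.range fun f => (π f, diagHom ρ f))) with hC
  have hPC : (P, constMatrix k (1 : A)) ∈ C := Algebra.subset_adjoin (Set.mem_insert _ _)
  have hfC : ∀ f, (π f, diagHom ρ f) ∈ C := fun f =>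
    Algebra.subset_adjoin (Set.mem_insert_of_mem _ ⟨f, rfl⟩)
  have hcomp : ∀ f, (P * π f * P, constMatrix k ((k : ℂ)⁻¹ • ∑ i, ρ i f)) ∈ C := fun f => by
    rw [← constMatrix_diagonal_constMatrix]
    exact mul_mem (mul_mem hPC (hfC f)) hPC
  ext q
  have hq : (Corner.val hP (FreeAlgebra.lift ℂ ![X, star X] q),
      constMatrix k (FreeAlgebra.lift ℂ ![Y, star Y] q)) ∈ C := by
    induction q using FreeAlgebra.induction with
    | grade0 r =>
      -- The unit of the corner is `P`, so scalars correspond to multiples of the two projections,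
      -- not of the two identities.
      convert C.smul_mem hPC r using 1
      rw [AlgHom.commutes, AlgHom.commutes, Algebra.algebraMap_eq_smul_one,
        Algebra.algebraMap_eq_smul_one, Corner.val_smul, Corner.val_one]
      ext
      · rfl
      · simp only [constMatrix, Matrix.of_apply, Prod.smul_mk, Matrix.smul_apply]
        rw [smul_comm]
    | grade1 x =>
      fin_cases x
      · simpa [hπ, hρ, X, Corner.val_compress] using hcomp (FreeAlgebra.ι ℂ 0)
      · have := hcomp (FreeAlgebra.ι ℂ 1)
        simpa [hπ, hρ, X, Corner.val_compress, Corner.val_star, hY, star_smul, mul_assoc,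
          hP.isSelfAdjoint.star_eq] using this
    | mul f g hf hg =>
      rw [map_mul, map_mul, map_mul, ← constMatrix_mul hk]
      exact mul_mem hf hg
    | add f g hf hg =>
      convert add_mem hf hg using 1
      rw [map_add, map_add, map_add]
      ext <;> simp [constMatrix]
  have h1 : matrixTrace τ k 1 = 1 := by
    simp [matrixTrace_apply, τ.map_one, hk']
  have hpP : constMatrix k (1 : A) * constMatrix k 1 = constMatrix k 1 := by
    rw [constMatrix_mul hk, one_mul]
  have key := eq_of_vanish_on_alternating (α := (k : ℂ)⁻¹) (φ := τ.toLinearMap)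
    (φ' := matrixTrace τ k) hψ1
    hP.isIdempotentElem hpP τ.map_one h1
    (hPS.map_wordEval_eq_zero (by rw [hτP, one_div]) (lift_mem_of_mem ha) fun _ => rfl)
    (matrixTrace_wordEval_eq_zero hT (fun i => lift_mem_of_mem (hb i)) hψρ) hq
  change (k : ℂ) * τ (Corner.val hP (FreeAlgebra.lift ℂ ![X, star X] q))
    = τ (FreeAlgebra.lift ℂ ![Y, star Y] q)
  -- The constant matrix of `a` has normalized trace `τ a / k`, which cancels the factor `k` of the
  -- compressed state.
  rw [key, matrixTrace_apply]
  simp [constMatrix, hk']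

end Compression

/-! ### Functional calculus and moments -/

section FunctionalCalculus

variable {A B : Type*} [CStarAlgebra A] [CStarAlgebra B]

/-- The difference of the two elements is the square of the self-adjoint element `cfc (√(g - f)) x`.
-/
theorem TracialState.re_cfc_mono (τ : TracialState A) {x : A} {f g : ℝ → ℝ}
    (hf : ContinuousOn f (spectrum ℝ x)) (hg : ContinuousOn g (spectrum ℝ x))
    (hfg : ∀ s ∈ spectrum ℝ x, f s ≤ g s) : (τ (cfc f x)).re ≤ (τ (cfc g x)).re := by
  have hc : ContinuousOn (fun s => Real.sqrt (g s - f s)) (spectrum ℝ x) :=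
    Real.continuous_sqrt.comp_continuousOn (hg.sub hf)
  have h : cfc g x - cfc f x = star (cfc (fun s => Real.sqrt (g s - f s)) x) *
      cfc (fun s => Real.sqrt (g s - f s)) x := by
    rw [(cfc_predicate (fun s => Real.sqrt (g s - f s)) x : IsSelfAdjoint _).star_eq,
      ← cfc_mul _ _ x hc hc, ← cfc_sub g f x hg hf]
    exact cfc_congr fun s hs => (Real.mul_self_sqrt (sub_nonneg.2 (hfg s hs))).symm
  have h0 := (Complex.nonneg_iff.1 (τ.nonneg (cfc (fun s => Real.sqrt (g s - f s)) x))).1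
  rw [← h, map_sub, Complex.sub_re] at h0
  linarith

/-- Monotonicity applied to `p - δ ≤ f ≤ p + δ` on the spectrum; positivity takes the place of a
norm bound on `τ`. -/
theorem TracialState.abs_re_cfc_sub_aeval_le (τ : TracialState A) {x : A} (hx : IsSelfAdjoint x)
    {f : ℝ → ℝ} (hf : ContinuousOn f (spectrum ℝ x)) (p : Polynomial ℝ) {δ : ℝ}
    (h : ∀ s ∈ spectrum ℝ x, |p.eval s - f s| ≤ δ) :
    |(τ (cfc f x)).re - (τ (Polynomial.aeval x p)).re| ≤ δ := by
  have hcp : ContinuousOn (fun s => p.eval s) (spectrum ℝ x) := p.continuous.continuousOn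
  have hp : ∀ c : ℝ, (τ (cfc (fun s => p.eval s + c) x)).re
      = (τ (Polynomial.aeval x p)).re + c := by
    intro c
    rw [cfc_add_const c _ x hcp, cfc_polynomial p x, map_add, Complex.add_re,
      IsScalarTower.algebraMap_apply ℝ ℂ A, Algebra.algebraMap_eq_smul_one (A := A), map_smul,
      τ.map_one]
    simp
  have h1 := τ.re_cfc_mono (x := x) hf (hcp.add continuousOn_const) (g := fun s => p.eval s + δ)
    fun s hs => by have := (abs_le.1 (h s hs)).1; linarith
  have h2 := τ.re_cfc_mono (x := x) (hcp.add continuousOn_const) hf (f := fun s => p.eval s + -δ)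
    fun s hs => by have := (abs_le.1 (h s hs)).2; linarith
  rw [hp] at h1 h2
  rw [abs_le]
  constructor <;> linarith

/-- The trace of a continuous function of a self-adjoint element depends only on its moments. -/
theorem re_cfc_eq_of_moments (τ : TracialState A) (τ' : TracialState B) {x : A} {y : B}
    (hx : IsSelfAdjoint x) (hy : IsSelfAdjoint y)
    (h : ∀ p : Polynomial ℝ, τ (Polynomial.aeval x p) = τ' (Polynomial.aeval y p))
    {f : ℝ → ℝ} {a b : ℝ} (hf : ContinuousOn f (Set.Icc a b)) (hxs : spectrum ℝ x ⊆ Set.Icc a b)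
    (hys : spectrum ℝ y ⊆ Set.Icc a b) : (τ (cfc f x)).re = (τ' (cfc f y)).re := by
  refine eq_of_abs_sub_le_all fun ε hε => ?_
  -- The interval contains both spectra, so one polynomial, accurate to `ε / 2`, serves both traces.
  obtain ⟨p, hp⟩ := exists_polynomial_near_of_continuousOn a b f hf (ε / 2) (half_pos hε)
  have h1 := abs_le.1 (τ.abs_re_cfc_sub_aeval_le hx (hf.mono hxs) p fun s hs => (hp s (hxs hs)).le)
  have h2 := abs_le.1 (τ'.abs_re_cfc_sub_aeval_le hy (hf.mono hys) p
    fun s hs => (hp s (hys hs)).le)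
  rw [h p] at h1
  rw [abs_le]
  constructor <;> linarith [h1.1, h1.2, h2.1, h2.2]

theorem map_aeval_eq_of_starDistribution_eq {τ : TracialState A} {τ' : TracialState B} {a : A}
    {b : B} (h : starDistribution τ a = starDistribution τ' b) (q : FreeAlgebra ℂ (Fin 2))
    (p : Polynomial ℝ) :
    τ (Polynomial.aeval (FreeAlgebra.lift ℂ ![a, star a] q) p)
      = τ' (Polynomial.aeval (FreeAlgebra.lift ℂ ![b, star b] q) p) := by
  rw [← Polynomial.aeval_map_algebraMap ℂ (FreeAlgebra.lift ℂ ![a, star a] q),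
    ← Polynomial.aeval_map_algebraMap ℂ (FreeAlgebra.lift ℂ ![b, star b] q),
    Polynomial.aeval_algHom_apply, Polynomial.aeval_algHom_apply]
  exact LinearMap.congr_fun h _

/-! ### Determinants, Brown measures and radial parts -/

theorem isSelfAdjoint_star_mul_self_add (a : A) (ε : ℝ) :
    IsSelfAdjoint (star a * a + algebraMap ℝ A ε) :=
  (IsSelfAdjoint.star_mul_self a).add (IsSelfAdjoint.algebraMap _ (IsSelfAdjoint.all ε))

/-- For `ε > 0` this keeps the spectrum away from the singularity of the logarithm. -/
theorem le_of_mem_spectrum_star_mul_self_add {a : A} {ε s : ℝ}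
    (hs : s ∈ spectrum ℝ (star a * a + algebraMap ℝ A ε)) : ε ≤ s := by
  rw [← sub_add_cancel s ε, add_comm (star a * a), spectrum.add_mem_add_iff] at hs
  exact sub_nonneg.1 (spectrum_star_mul_self_nonneg _ hs)

theorem fkDet_eq_of_starDistribution_eq {τ : TracialState A} {τ' : TracialState B} {a : A}
    {b : B} (h : starDistribution τ a = starDistribution τ' b) (z : ℂ) :
    fkDet τ (a - algebraMap ℂ A z) = fkDet τ' (b - algebraMap ℂ B z) := by
  refine iInf_congr fun ⟨ε, hε⟩ => ?_
  congr 2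
  set x := star (a - algebraMap ℂ A z) * (a - algebraMap ℂ A z) + algebraMap ℝ A ε with hx
  set y := star (b - algebraMap ℂ B z) * (b - algebraMap ℂ B z) + algebraMap ℝ B ε with hy
  obtain ⟨m, hm⟩ := ((spectrum.isCompact (𝕜 := ℝ) x).union
    (spectrum.isCompact (𝕜 := ℝ) y)).bddAbove
  -- The regularized `|a - z|² + ε` as a noncommutative polynomial, with the second indeterminate
  -- standing for the adjoint.
  set q : FreeAlgebra ℂ (Fin 2) :=
    (FreeAlgebra.ι ℂ 1 - algebraMap ℂ _ (star z)) * (FreeAlgebra.ι ℂ 0 - algebraMap ℂ _ z)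
      + algebraMap ℂ _ (ε : ℂ) with hq
  have hqx : FreeAlgebra.lift ℂ ![a, star a] q = x := by
    simp [hq, hx, ← algebraMap_star_comm, IsScalarTower.algebraMap_apply ℝ ℂ A]
  have hqy : FreeAlgebra.lift ℂ ![b, star b] q = y := by
    simp [hq, hy, ← algebraMap_star_comm, IsScalarTower.algebraMap_apply ℝ ℂ B]
  refine re_cfc_eq_of_moments τ τ' (isSelfAdjoint_star_mul_self_add _ _)
    (isSelfAdjoint_star_mul_self_add _ _) (a := ε) (b := m) (fun p => ?_) ?_ ?_ ?_
  · simpa only [hqx, hqy] using map_aeval_eq_of_starDistribution_eq h q p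
  · exact Real.continuousOn_log.mono fun s hs => (hε.trans_le hs.1).ne'
  · exact fun s hs => ⟨le_of_mem_spectrum_star_mul_self_add hs, hm (Or.inl hs)⟩
  · exact fun s hs => ⟨le_of_mem_spectrum_star_mul_self_add hs, hm (Or.inr hs)⟩

theorem brownDistribution_eq_of_starDistribution_eq {τ : TracialState A} {τ' : TracialState B}
    {a : A} {b : B} (h : starDistribution τ a = starDistribution τ' b) (f : ℂ → ℝ) :
    brownDistribution τ a f = brownDistribution τ' b f := by
  simp only [brownDistribution, fkDet_eq_of_starDistribution_eq h]

theorem spectralDistribution_eq_of_starDistribution_eq {τ : TracialState A}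
    {τ' : TracialState B} {a : A} {b : B} (h : starDistribution τ a = starDistribution τ' b) :
    spectralDistribution τ (a * star a) (IsSelfAdjoint.mul_star_self a)
      = spectralDistribution τ' (b * star b) (IsSelfAdjoint.mul_star_self b) := by
  have hfun : spectralFunctional τ (a * star a) = spectralFunctional τ' (b * star b) := by
    ext f
    change (τ (cfc (fun s : ℝ => f s) (a * star a))).re
      = (τ' (cfc (fun s : ℝ => f s) (b * star b))).re
    have hK := (spectrum.isCompact (𝕜 := ℝ) (a * star a)).union
      (spectrum.isCompact (𝕜 := ℝ) (b * star b))
    obtain ⟨m, hm⟩ := hK.bddAbove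
    obtain ⟨l, hl⟩ := hK.bddBelow
    refine re_cfc_eq_of_moments τ τ' (IsSelfAdjoint.mul_star_self a)
      (IsSelfAdjoint.mul_star_self b) (fun p => ?_) (f.continuous.continuousOn (s := Set.Icc l m))
      (fun s hs => ⟨hl (Or.inl hs), hm (Or.inl hs)⟩) (fun s hs => ⟨hl (Or.inr hs), hm (Or.inr hs)⟩)
    have hp := map_aeval_eq_of_starDistribution_eq h (FreeAlgebra.ι ℂ 0 * FreeAlgebra.ι ℂ 1) p
    rw [map_mul, map_mul] at hp
    simpa only [FreeAlgebra.lift_ι_apply, Matrix.cons_val_zero, Matrix.cons_val_one] using hp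
  rw [spectralDistribution, spectralDistribution, hfun]

end FunctionalCalculus

theorem IsFreeUnitaryBrownianMotion.map_pow {A : Type*} [CStarAlgebra A] {τ : TracialState A}
    {U : ℝ≥0 → A} (hU : IsFreeUnitaryBrownianMotion τ U) (t : ℝ≥0) {n : ℕ} (hn : 1 ≤ n) :
    τ (U t ^ n) = (fubmMoment t n : ℂ) := by
  simpa [hU.zero] using hU.law 0 t zero_le n hn

end FreeProb

end

open FreeProb in
theorem mainTheorem3 {A : Type*} [CStarAlgebra A] (τ : TracialState A)
    (k : ℕ) (hk : 2 ≤ k)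
    (U : ℝ≥0 → A) (hU : IsFreeUnitaryBrownianMotion τ U)
    (P : A) (hP : IsStarProjection P) (hτP : τ P = 1 / (k : ℂ))
    (hPU : IsFree τ ![StarAlgebra.adjoin ℂ {P}, StarAlgebra.adjoin ℂ (Set.range U)])
    (V : Fin k → ℝ≥0 → A) (hV : ∀ j, IsFreeUnitaryBrownianMotion τ (V j))
    (hVfree : IsFree τ fun j => StarAlgebra.adjoin ℂ (Set.range (V j)))
    (t : ℝ≥0) :
    let σ : TracialState (Corner hP) :=
      τ.compress hP k (Nat.ne_of_gt (Nat.lt_of_lt_of_le Nat.two_pos hk)) hτP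
    let X : Corner hP := Corner.compress hP (U t)
    let Y : A := (k : ℂ)⁻¹ • ∑ j, V j t
    starDistribution σ X = starDistribution τ Y ∧
    (∀ f : ℂ → ℝ, ContDiff ℝ ∞ f → HasCompactSupport f →
      brownDistribution σ X f = brownDistribution τ Y f) ∧
    (∀ μ : MeasureTheory.Measure ℂ, IsBrownMeasure σ X μ ↔ IsBrownMeasure τ Y μ) ∧
    spectralDistribution σ (X * star X) (IsSelfAdjoint.mul_star_self X)
      = spectralDistribution τ (Y * star Y) (IsSelfAdjoint.mul_star_self Y) := by
  intro σ X Y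
  have hdist : starDistribution σ X = starDistribution τ Y := by
    refine starDistribution_compress_eq τ _ hP hτP hPU
      (StarAlgebra.subset_adjoin ℂ _ (Set.mem_range_self t)) hVfree
      (fun j => StarAlgebra.subset_adjoin ℂ _ (Set.mem_range_self t)) fun j => ?_
    -- The moment formula is never evaluated; it matters only that both unitaries have the same
    -- moments.
    exact starDistribution_eq_of_unitary τ τ ((hV j).unitary t) (hU.unitary t) fun n hn => by
      rw [(hV j).map_pow t hn, hU.map_pow t hn]
  have hbrown : ∀ f, brownDistribution σ X f = brownDistribution τ Y f :=
    brownDistribution_eq_of_starDistribution_eq hdist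
  refine ⟨hdist, fun f _ _ => hbrown f, fun μ => ?_,
    spectralDistribution_eq_of_starDistribution_eq hdist⟩
  simp only [IsBrownMeasure, hbrown]
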